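/- Let $G$ be the grid of unit edges between the integer points of the plane. A tiling is a map from the edges of $G$ to a finite set of colors; its tiles (crosses) are the ordered color combinations of the four edges forming a unit square (sharing a corner). A palette ($+$palette) $P$ is a set of tiles (crosses) over a finite color set, and a $P$-tiling is a tiling all of whose tiles (crosses) belong to $P$. A map $f$ of the colors of $P$ to another alphabet turns each $P$-tiling $T$ into the tiling $f\circ T$; $(P,f)$ enforces exactly a set $S$ of tilings if $\{f\circ T : T \text{ a } P\text{-tiling}\}=S$. The central tiling $C$ has colors $\{0,1\}$ (bracket bits): a vertical edge with horizontal coordinate $x=(2i+1)2^k$ (with $k\ge 0$ and $i$ integers) has the color $i \bmod 2$, a horizontal edge with vertical coordinate $y=(2j+1)2^l$ has the color $j\bmod 2$, and the edges of the vertical axis $x=0$ and of the horizontal axis $y=0$ have two arbitrary default colors $d_1,d_2$. For 2-adic integers $a,b$, the shift of $C$ by $(a,b)$ is the tiling that is the pointwise limit of the shifts of $C$ by integer vectors converging 2-adically to $(a,b)$, except that the vertical edges with coordinate $x=a$ (present only if $a\in\mathbb Z$) have the default color $d_1$, and the horizontal edges with coordinate $y=b$ (present only if $b\in\mathbb Z$)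 have the default color $d_2$. The reflections of a $\{0,1\}$-tiling are its images under the eight symmetries of the square generated by the reversal of the horizontal coordinate (which also flips the colors of all vertical edges), the reversal of the vertical coordinate (which also flips the colors of all horizontal edges), and the diagonal exchange of the two coordinates. Theorem. Let $S$ be the set of all reflections of shifts of $C$ by 2-adic vectors $(a,b)\in\mathbb Z_2^2$. There are a palette $P$ over a finite color set and a map $f$ of its colors to $\{0,1\}$ such that $(P,f)$ enforces exactly $S$, and no $P$-tiling is periodic, that is, unchanged by a shift by a nonzero integer vector. The same holds with a $+$palette in place of the palette. -/

import Mathlib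

open Filter Topology

namespace BracketTiling

/-- The unit edges of the integer grid of the plane: `vert x y` joins `(x, y)` to `(x, y + 1)`,
and `horiz x y` joins `(x, y)` to `(x + 1, y)`. -/
inductive Edge : Type
  | vert (x y : ℤ)
  | horiz (x y : ℤ)

/-- A tiling colors the edges of the grid (the color types used are finite). -/
abbrev Tiling (K : Type) : Type := Edge → K

/-- Ordered color combinations of the four edges of a unit square. -/
structure Tile (K : Type) : Type where
  left : K
  right : K
  bottom : K
  top : K

/-- Ordered color combinations of the four edges sharing a corner. -/
structure Cross (K : Type) : Type where
  west : K
  east : K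
  south : K
  north : K

/-- The tile of `T` on the unit square with lower left corner `(x, y)`. -/
def Tiling.tileAt {K : Type} (T : Tiling K) (x y : ℤ) : Tile K where
  left := T (.vert x y)
  right := T (.vert (x + 1) y)
  bottom := T (.horiz x y)
  top := T (.horiz x (y + 1))

/-- The cross of `T` at the grid point `(x, y)`. -/
def Tiling.crossAt {K : Type} (T : Tiling K) (x y : ℤ) : Cross K where
  west := T (.horiz (x - 1) y)
  east := T (.horiz x y)
  south := T (.vert x (y - 1))
  north := T (.vert x y)

/-- The tilings all of whose tiles belong to the palette `P`. -/
def paletteTilings {K : Type} (P : Set (Tile K)) : Set (Tiling K) :=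
  {T | ∀ x y : ℤ, T.tileAt x y ∈ P}

/-- The tilings all of whose crosses belong to the +palette `P`. -/
def crossPaletteTilings {K : Type} (P : Set (Cross K)) : Set (Tiling K) :=
  {T | ∀ x y : ℤ, T.crossAt x y ∈ P}

/-- Replacing the colors of a tiling according to `f`. -/
def Tiling.recolor {K L : Type} (f : K → L) (T : Tiling K) : Tiling L := fun e => f (T e)

/-- A set `A` of tilings (those admitted by a palette or a +palette), with the color map `f`,
enforces exactly the set `S`: recoloring turns each tiling of `A` into a tiling of `S`, and each
tiling of `S` is obtained in this way. -/
def EnforcesExactly {K L : Type} (A : Set (Tiling K)) (f : K → L) (S : Set (Tiling L)) : Prop :=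
  (∀ T ∈ A, T.recolor f ∈ S) ∧ (∀ U ∈ S, ∃ T ∈ A, T.recolor f = U)

/-- The shift of a tiling by the integer vector `p`. -/
def Tiling.shift {K : Type} (p : ℤ × ℤ) (T : Tiling K) : Tiling K
  | .vert x y => T (.vert (x - p.1) (y - p.2))
  | .horiz x y => T (.horiz (x - p.1) (y - p.2))

/-- A tiling is periodic if some nonzero integer shift leaves it unchanged. -/
def Tiling.IsPeriodic {K : Type} (T : Tiling K) : Prop :=
  ∃ p : ℤ × ℤ, p ≠ 0 ∧ T.shift p = T

open Classical in
/-- The one-dimensional tiling by brackets: the bracket bit at `x = (2 i + 1) 2 ^ k` is `i mod 2`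
(`true` for odd `i`), and the unranked bracket at the origin is the default `d`. -/
noncomputable def bracket (d : Bool) (x : ℤ) : Bool :=
  if x = 0 then d else decide (∃ (k : ℕ) (i : ℤ), x = (2 * i + 1) * 2 ^ k ∧ Odd i)

/-- The central tiling, with default `d₁` on the vertical axis and `d₂` on the horizontal one. -/
noncomputable def central (d₁ d₂ : Bool) : Tiling Bool
  | .vert x _ => bracket d₁ x
  | .horiz _ y => bracket d₂ y

/-- The filter of integer vectors that approximate the 2-adic vector `(a, b)`. -/
noncomputable def approx (a b : ℤ_[2]) : Filter (ℤ × ℤ) :=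
  comap (fun p : ℤ × ℤ => ((p.1 : ℤ_[2]), (p.2 : ℤ_[2]))) (𝓝 (a, b))

/-- `T` is the shift of the central tiling by the 2-adic vector `(a, b)`: the pointwise limit of
its shifts by integer vectors approximating `(a, b)`, except on the shifted axes (which exist only
where `a`, respectively `b`, is an integer), whose brackets are the defaults. -/
structure IsTwoAdicShift (d₁ d₂ : Bool) (a b : ℤ_[2]) (T : Tiling Bool) : Prop where
  vert_limit : ∀ x y : ℤ, (x : ℤ_[2]) ≠ a →
    ∀ᶠ p in approx a b, (central d₁ d₂).shift p (.vert x y) = T (.vert x y)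
  vert_axis : ∀ x y : ℤ, (x : ℤ_[2]) = a → T (.vert x y) = d₁
  horiz_limit : ∀ x y : ℤ, (y : ℤ_[2]) ≠ b →
    ∀ᶠ p in approx a b, (central d₁ d₂).shift p (.horiz x y) = T (.horiz x y)
  horiz_axis : ∀ x y : ℤ, (y : ℤ_[2]) = b → T (.horiz x y) = d₂

/-- Reflection reversing the horizontal coordinate. The brackets of the vertical edges point to
the left or to the right, and so are reversed. -/
def Tiling.reflectX (T : Tiling Bool) : Tiling Bool
  | .vert x y => !(T (.vert (-x) y))
  | .horiz x y => T (.horiz (-x - 1) y)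

/-- Reflection reversing the vertical coordinate. -/
def Tiling.reflectY (T : Tiling Bool) : Tiling Bool
  | .vert x y => T (.vert x (-y - 1))
  | .horiz x y => !(T (.horiz x (-y)))

/-- The diagonal reflection, exchanging the two coordinates. -/
def Tiling.reflectDiag (T : Tiling Bool) : Tiling Bool
  | .vert x y => T (.horiz y x)
  | .horiz x y => T (.vert y x)

/-- The eight reflections (symmetries of the square, including the identity). -/
def Tiling.reflect (r₁ r₂ r₃ : Bool) (T : Tiling Bool) : Tiling Bool :=
  let T₁ := if r₁ then T.reflectX else T
  let T₂ := if r₂ then T₁.reflectY else T₁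
  if r₃ then T₂.reflectDiag else T₂

/-- The set of 2-adic shifts and reflections of the central tiling with defaults `d₁`, `d₂`. -/
def shiftsAndReflections (d₁ d₂ : Bool) : Set (Tiling Bool) :=
  {U | ∃ (a b : ℤ_[2]) (T : Tiling Bool) (r₁ r₂ r₃ : Bool),
    IsTwoAdicShift d₁ d₂ a b T ∧ U = T.reflect r₁ r₂ r₃}

end BracketTiling

/-!
In the central tiling, and in its shifts, the color of a vertical edge depends on its abscissa only
and that of a horizontal edge on its ordinate only, and both sequences of colors are paperfolding
sequences: at `x = a + 2 ^ k * (2 * i + 1)`, a position of rank `k`, the color is the parity of `i`.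
The reversal of a paperfolding sequence is a paperfolding sequence, so the reflections change nothing
but the defaults, and the set to be enforced consists of all products of two paperfolding sequences
with arbitrary defaults (`mem_shiftsAndReflections_iff`). None of these is periodic, as a
paperfolding sequence has no period (`IsPaperfolding.eq_zero_of_periodic`).

To enforce paperfolding sequences by a local rule, each cell, where a column meets a row, stores the
comparison of their ranks, the phase of the row with respect to the column brackets of the rank of
the row, and the phase of the column, defined symmetrically. Thus the rows of rank `k` see the
columns of rank less than `k` as absent, and check that the brackets of rank `k` alternate, with
exactly one column of larger rank between consecutive ones. What remains to be forced is the
comparison marks. Those of rank `0` are forced by parity. For the next rank, the rows of rank `0`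
put the columns of positive rank alternately inside and outside their pairs of brackets. In a column
inside, all rows of rank `0` are half-steps, and the half-step rule (`HalfStep`) requires a full step
between any two of them, so that this column steps at all rows of positive rank; the alternation of
its phases then shows which of these have the same rank and which have a larger one
(`RowRule.cmp_even`). Hence the configuration restricted to the columns and rows of positive rank
satisfies the same rules (`RowRule.renormalize`), and by induction the whole hierarchy is forced; the
2-adic limit of the origins of the successive sublattices is the centre
(`exists_isPaperfolding_of_renormalizable`). Conversely, for all paperfolding sequences the true
ranks, which are 2-adic valuations of `x - a`, and the quotients of `x - a` by powers of `2`, taken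
modulo `4` as phases, satisfy the rules (`IsPaperfolding.exists_phaseSystem`).

A nearest-neighbor rule on cells is expressed both by a palette and by a +palette, by writing the
state of the cell `(x, y)` on the edges leaving `(x, y)` upward and to the right (`ofCells`).
-/

namespace BracketTiling

/-! ### Paperfolding sequences -/

/-- `u` is the two-sided paperfolding sequence centred at the 2-adic integer `a`: at
`x = a + 2 ^ k * (2 * i + 1)` its value is the parity of `i`. Since only the parity of `i` matters,
the position is prescribed modulo `2 ^ (k + 2)` only. The value at `x = a` is not constrained. -/
def IsPaperfolding (a : ℤ_[2]) (u : ℤ → Bool) : Prop :=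
  ∀ (k : ℕ) (i x : ℤ), (2 : ℤ_[2]) ^ (k + 2) ∣ x - (a + 2 ^ k * (2 * i + 1)) → u x = decide (Odd i)

theorem two_pow_dvd_intCast_iff (n : ℕ) (m : ℤ) :
    (2 : ℤ_[2]) ^ n ∣ (m : ℤ_[2]) ↔ (2 : ℤ) ^ n ∣ m := by
  have h := PadicInt.norm_int_le_pow_iff_dvd (p := 2) (k := m) (n := n)
  have h' := PadicInt.norm_le_pow_iff_mem_span_pow (p := 2) (m : ℤ_[2]) n
  rw [h', Ideal.mem_span_singleton] at h
  exact_mod_cast h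

theorem exists_int_two_pow_dvd_sub (a : ℤ_[2]) (n : ℕ) :
    ∃ m : ℤ, (2 : ℤ_[2]) ^ n ∣ (m : ℤ_[2]) - a := by
  have h := PadicInt.appr_spec (p := 2) n a
  rw [Ideal.mem_span_singleton] at h
  refine ⟨a.appr n, ?_⟩
  rw [← dvd_neg]
  simpa using h

theorem eventually_two_pow_dvd_sub (a : ℤ_[2]) (n : ℕ) :
    ∀ᶠ z in 𝓝 a, (2 : ℤ_[2]) ^ n ∣ z - a := by
  have hpos : (0 : ℝ) < (2 : ℝ) ^ (-(n : ℤ)) := by positivity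
  filter_upwards [Metric.closedBall_mem_nhds a hpos] with z hz
  rw [Metric.mem_closedBall, dist_eq_norm] at hz
  have h := (PadicInt.norm_le_pow_iff_mem_span_pow (p := 2) (z - a) n).1 (by exact_mod_cast hz)
  rw [Ideal.mem_span_singleton] at h
  exact_mod_cast h

instance approx_neBot (a b : ℤ_[2]) : (approx a b).NeBot := by
  have h : DenseRange (fun p : ℤ × ℤ => ((p.1 : ℤ_[2]), (p.2 : ℤ_[2]))) :=
    (PadicInt.denseRange_intCast (p := 2)).prodMap (PadicInt.denseRange_intCast (p := 2))
  refine comap_neBot fun s hs => ?_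
  obtain ⟨_, hz, p, rfl⟩ := mem_closure_iff_nhds.1 (h (a, b)) s hs
  exact ⟨p, hz⟩

theorem exists_two_pow_dvd_sub_odd {a : ℤ_[2]} {x : ℤ} (hx : (x : ℤ_[2]) ≠ a) :
    ∃ (k : ℕ) (i : ℤ), (2 : ℤ_[2]) ^ (k + 2) ∣ x - (a + 2 ^ k * (2 * i + 1)) := by
  have hne : (x : ℤ_[2]) - a ≠ 0 := sub_ne_zero.2 hx
  have hfin : FiniteMultiplicity (2 : ℤ_[2]) (x - a) :=
    FiniteMultiplicity.of_prime_left (by exact_mod_cast PadicInt.prime_p (p := 2)) hne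
  obtain ⟨z, hz, hodd⟩ := hfin.exists_eq_pow_mul_and_not_dvd
  obtain ⟨m, hm⟩ := exists_int_two_pow_dvd_sub z 2
  rcases Int.even_or_odd m with hme | ⟨i, rfl⟩
  · exfalso
    apply hodd
    have h2 : (2 : ℤ_[2]) ∣ m := by
      have := (two_pow_dvd_intCast_iff 1 m).2 (by simpa using hme.two_dvd)
      simpa using this
    have h3 : (2 : ℤ_[2]) ∣ m - z := (dvd_pow_self 2 two_ne_zero).trans hm
    simpa using dvd_sub h2 h3
  · set k := multiplicity (2 : ℤ_[2]) (x - a)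
    refine ⟨k, i, ?_⟩
    obtain ⟨w, hw⟩ := hm
    refine ⟨-w, ?_⟩
    rw [pow_add, ← sub_sub, hz]
    push_cast at hw
    linear_combination (-2 ^ k) * hw

theorem bracket_eq_of_dvd (d : Bool) {k : ℕ} {i n : ℤ}
    (h : (2 : ℤ) ^ (k + 2) ∣ n - 2 ^ k * (2 * i + 1)) : bracket d n = decide (Odd i) := by
  obtain ⟨w, hw⟩ := h
  have hn : n = (2 * (i + 2 * w) + 1) * 2 ^ k := by
    rw [pow_add] at hw
    linear_combination hw
  have h0 : n ≠ 0 := by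
    rw [hn]
    exact mul_ne_zero (by omega) (by positivity)
  have key : ∀ (l : ℕ) (j : ℤ), n = (2 * j + 1) * 2 ^ l → j = i + 2 * w := by
    intro l j hj
    have hpow : ∀ (k l : ℕ) (i j : ℤ), (2 * i + 1) * 2 ^ k = (2 * j + 1) * 2 ^ l → k ≤ l := by
      intro k l i j h
      by_contra! hlt
      obtain ⟨m, rfl⟩ := Nat.exists_eq_add_of_lt hlt
      have : (2 * i + 1) * 2 ^ (m + 1) = 2 * j + 1 := by
        have h2 : (2 : ℤ) ^ l ≠ 0 := by positivity
        apply mul_right_cancel₀ h2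
        rw [← h]
        ring
      rw [pow_succ, ← mul_assoc] at this
      omega
    have hkl : k = l := le_antisymm (hpow _ _ _ _ (hn ▸ hj)) (hpow _ _ _ _ (hj.symm.trans hn))
    subst hkl
    have h2 : (2 : ℤ) ^ k ≠ 0 := by positivity
    have := mul_right_cancel₀ h2 (hj.symm.trans hn)
    omega
  rw [bracket, if_neg h0, decide_eq_decide]
  constructor
  · rintro ⟨l, j, hj, hodd⟩
    rw [key l j hj] at hodd
    simpa [Int.odd_add, Int.even_mul] using hodd
  · intro hodd
    exact ⟨k, _, hn, hodd.add_even (even_two_mul w)⟩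

/-- An integer shift of the brackets by `p` agrees with the paperfolding sequence centred at `a` at
the position `x` as soon as `p` is 2-adically close to `a`. -/
theorem eventually_bracket_sub (d : Bool) {a : ℤ_[2]} {k : ℕ} {i x : ℤ}
    (h : (2 : ℤ_[2]) ^ (k + 2) ∣ x - (a + 2 ^ k * (2 * i + 1))) :
    ∀ᶠ z in 𝓝 a, ∀ p : ℤ, (p : ℤ_[2]) = z → bracket d (x - p) = decide (Odd i) := by
  filter_upwards [eventually_two_pow_dvd_sub a (k + 2)] with z hz p hp
  subst hp
  apply bracket_eq_of_dvd (k := k)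
  rw [← two_pow_dvd_intCast_iff]
  push_cast
  have := dvd_sub h hz
  convert this using 1
  ring

theorem IsPaperfolding.eventually_bracket_sub (d : Bool) {a : ℤ_[2]} {u : ℤ → Bool}
    (hu : IsPaperfolding a u) {x : ℤ} (hx : (x : ℤ_[2]) ≠ a) :
    ∀ᶠ z in 𝓝 a, ∀ p : ℤ, (p : ℤ_[2]) = z → bracket d (x - p) = u x := by
  obtain ⟨k, i, h⟩ := exists_two_pow_dvd_sub_odd hx
  rw [hu k i x h]
  exact BracketTiling.eventually_bracket_sub d h

theorem IsPaperfolding.reverse {a : ℤ_[2]} {u : ℤ → Bool} (hu : IsPaperfolding a u) :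
    IsPaperfolding (-a) fun x => !u (-x) := by
  intro k i x h
  have := hu k (-i - 1) (-x) (by
    rw [← dvd_neg]
    convert h using 1
    push_cast
    ring)
  simp only [this]
  rcases Int.even_or_odd i with hi | hi
  all_goals simp [hi]

theorem IsPaperfolding.translate {a : ℤ_[2]} {u : ℤ → Bool} {s : ℤ}
    (hu : IsPaperfolding a fun x => u (s + x)) : IsPaperfolding (a + s) u := by
  intro k i x h
  have := hu k i (x - s) (by
    convert h using 1
    push_cast
    ring)
  simpa using this

/-- A paperfolding sequence has no period: twice a period `2 ^ k * (2 * j + 1)` would exchange the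
two values at the positions of rank `k`. -/
theorem IsPaperfolding.eq_zero_of_periodic {a : ℤ_[2]} {u : ℤ → Bool} (hu : IsPaperfolding a u)
    {p : ℤ} (hp : ∀ x, u (x - p) = u x) : p = 0 := by
  by_contra h0
  have hfin : FiniteMultiplicity (2 : ℤ) p := FiniteMultiplicity.of_prime_left Int.prime_two h0
  obtain ⟨q, hq, hodd⟩ := hfin.exists_eq_pow_mul_and_not_dvd
  set k := multiplicity (2 : ℤ) p
  obtain ⟨j, rfl⟩ : Odd q := by
    rw [← Int.not_even_iff_odd, even_iff_two_dvd]
    exact hodd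
  obtain ⟨m, hm⟩ := exists_int_two_pow_dvd_sub a (k + 2)
  have h1 := hu k 0 (m + 2 ^ k) (by
    convert hm using 1
    push_cast
    ring)
  have h2 := hu k 1 (m + 2 ^ k - p - p) (by
    obtain ⟨w, hw⟩ := hm
    refine ⟨w - j - 1, ?_⟩
    rw [hq]
    push_cast
    rw [pow_add] at hw ⊢
    linear_combination hw)
  rw [hp, hp, h1] at h2
  simp at h2

/-- The tiling whose vertical edges are colored by `u` and horizontal ones by `v`. -/
def productTiling (u v : ℤ → Bool) : Tiling Bool
  | .vert x _ => u x
  | .horiz _ y => v y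

theorem isTwoAdicShift_iff {d₁ d₂ : Bool} {a b : ℤ_[2]} {T : Tiling Bool} :
    IsTwoAdicShift d₁ d₂ a b T ↔ ∃ u v, T = productTiling u v ∧
      (IsPaperfolding a u ∧ ∀ x : ℤ, (x : ℤ_[2]) = a → u x = d₁) ∧
      (IsPaperfolding b v ∧ ∀ y : ℤ, (y : ℤ_[2]) = b → v y = d₂) := by
  have hfst : Tendsto (fun p : ℤ × ℤ => (p.1 : ℤ_[2])) (approx a b) (𝓝 a) :=
    (continuous_fst.tendsto (a, b)).comp tendsto_comap
  have hsnd : Tendsto (fun p : ℤ × ℤ => (p.2 : ℤ_[2])) (approx a b) (𝓝 b) :=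
    (continuous_snd.tendsto (a, b)).comp tendsto_comap
  have hne : ∀ {c : ℤ_[2]} {k : ℕ} {i x : ℤ},
      (2 : ℤ_[2]) ^ (k + 2) ∣ x - (c + 2 ^ k * (2 * i + 1)) → (x : ℤ_[2]) ≠ c := by
    rintro c k i x h rfl
    have h' : (2 : ℤ) ^ (k + 2) ∣ -(2 ^ k * (2 * i + 1)) := by
      rw [← two_pow_dvd_intCast_iff]
      convert h using 1
      push_cast
      ring
    rw [dvd_neg, pow_add] at h'
    have := Int.dvd_of_mul_dvd_mul_left (by positivity) h'
    omega
  constructor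
  · intro hT
    have hvert : ∀ (k : ℕ) (i x y : ℤ), (2 : ℤ_[2]) ^ (k + 2) ∣ x - (a + 2 ^ k * (2 * i + 1)) →
        T (.vert x y) = decide (Odd i) := by
      intro k i x y h
      obtain ⟨p, hp, hp'⟩ := ((hT.vert_limit x y (hne h)).and
        (hfst.eventually (eventually_bracket_sub d₁ h))).exists
      rw [← hp, ← hp' p.1 rfl]
      rfl
    have hhoriz : ∀ (k : ℕ) (i x y : ℤ), (2 : ℤ_[2]) ^ (k + 2) ∣ y - (b + 2 ^ k * (2 * i + 1)) →
        T (.horiz x y) = decide (Odd i) := by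
      intro k i x y h
      obtain ⟨p, hp, hp'⟩ := ((hT.horiz_limit x y (hne h)).and
        (hsnd.eventually (eventually_bracket_sub d₂ h))).exists
      rw [← hp, ← hp' p.2 rfl]
      rfl
    refine ⟨fun x => T (.vert x 0), fun y => T (.horiz 0 y), ?_,
      ⟨fun k i x h => hvert k i x 0 h, fun x hx => hT.vert_axis x 0 hx⟩,
      ⟨fun k i y h => hhoriz k i 0 y h, fun y hy => hT.horiz_axis 0 y hy⟩⟩
    ext e
    rcases e with ⟨x, y⟩ | ⟨x, y⟩
    · by_cases hx : (x : ℤ_[2]) = a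
      · simp only [productTiling, hT.vert_axis x _ hx]
      · obtain ⟨k, i, h⟩ := exists_two_pow_dvd_sub_odd hx
        simp only [productTiling, hvert k i x _ h]
    · by_cases hy : (y : ℤ_[2]) = b
      · simp only [productTiling, hT.horiz_axis _ y hy]
      · obtain ⟨k, i, h⟩ := exists_two_pow_dvd_sub_odd hy
        simp only [productTiling, hhoriz k i _ y h]
  · rintro ⟨u, v, rfl, ⟨hu, hua⟩, hv, hvb⟩
    refine ⟨fun x y hx => ?_, fun x y hx => hua x hx, fun x y hy => ?_, fun x y hy => hvb y hy⟩
    · filter_upwards [hfst.eventually (hu.eventually_bracket_sub d₁ hx)] with p hp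
      exact hp p.1 rfl
    · filter_upwards [hsnd.eventually (hv.eventually_bracket_sub d₂ hy)] with p hp
      exact hp p.2 rfl

theorem forall_eq_or_forall_eq_not {a : ℤ_[2]} (d : Bool) (u : ℤ → Bool) :
    (∀ x : ℤ, (x : ℤ_[2]) = a → u x = d) ∨ (∀ x : ℤ, (x : ℤ_[2]) = a → u x = !d) := by
  by_cases h : ∃ x : ℤ, (x : ℤ_[2]) = a
  · obtain ⟨x₀, rfl⟩ := h
    rcases Bool.eq_or_eq_not (u x₀) d with h | h
    · left
      intro x hx
      rwa [Int.cast_injective hx]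
    · right
      intro x hx
      rwa [Int.cast_injective hx]
  · left
    intro x hx
    exact absurd ⟨x, hx⟩ h

/-- A paperfolding sequence, or its reversal, has a prescribed default at its centre. -/
theorem IsPaperfolding.exists_reverse {a : ℤ_[2]} (d : Bool) {u : ℤ → Bool}
    (hu : IsPaperfolding a u) : ∃ (r : Bool) (a' : ℤ_[2]) (w : ℤ → Bool),
      (u = if r then fun x => !w (-x) else w) ∧
      IsPaperfolding a' w ∧ ∀ x : ℤ, (x : ℤ_[2]) = a' → w x = d := by
  rcases forall_eq_or_forall_eq_not (a := a) d u with h | h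
  · exact ⟨false, a, u, rfl, hu, h⟩
  · refine ⟨true, -a, fun x => !u (-x), by simp, hu.reverse, fun x hx => ?_⟩
    have := h (-x) (by push_cast; rw [hx, neg_neg])
    simp [this]

/-- The reflections only change the defaults and exchange the coordinates, since the reversal of a
paperfolding sequence is again one. -/
theorem mem_shiftsAndReflections_iff {d₁ d₂ : Bool} {U : Tiling Bool} :
    U ∈ shiftsAndReflections d₁ d₂ ↔ ∃ u v, U = productTiling u v ∧
      (∃ a, IsPaperfolding a u) ∧ ∃ b, IsPaperfolding b v := by
  have hX : ∀ u v, (productTiling u v).reflectX = productTiling (fun x => !u (-x)) v := by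
    intro u v
    ext e
    cases e <;> rfl
  have hY : ∀ u v, (productTiling u v).reflectY = productTiling u (fun y => !v (-y)) := by
    intro u v
    ext e
    cases e <;> rfl
  have hD : ∀ u v, (productTiling u v).reflectDiag = productTiling v u := by
    intro u v
    ext e
    cases e <;> rfl
  constructor
  · rintro ⟨a, b, T, r₁, r₂, r₃, hT, rfl⟩
    obtain ⟨u, v, rfl, ⟨hu, -⟩, hv, -⟩ := isTwoAdicShift_iff.1 hT
    have hu' := hu.reverse
    have hv' := hv.reverse
    cases r₁ <;> cases r₂ <;> cases r₃ <;>
      simp only [Tiling.reflect, hX, hY, hD, if_true, if_false, Bool.false_eq_true] <;>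
      exact ⟨_, _, rfl, ⟨_, by assumption⟩, ⟨_, by assumption⟩⟩
  · rintro ⟨u, v, rfl, ⟨a, hu⟩, b, hv⟩
    obtain ⟨r₁, a', u', rfl, hu'⟩ := hu.exists_reverse d₁
    obtain ⟨r₂, b', v', rfl, hv'⟩ := hv.exists_reverse d₂
    refine ⟨a', b', productTiling u' v', r₁, r₂, false,
      isTwoAdicShift_iff.2 ⟨u', v', rfl, hu', hv'⟩, ?_⟩
    cases r₁ <;> cases r₂ <;> simp [Tiling.reflect, hX, hY]

/-! ### Renormalization of sequences -/

/-- In a sequence whose odd positions carry the alternating brackets of rank `0`, the even residue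
modulo `4` that lies outside the pairs of brackets of rank `0`: the brackets of rank at least `2`,
and the centre, are there. -/
def evenCenter (u : ℤ → Bool) : ℤ := if u 1 then 2 else 0

theorem decide_odd_add_one (n : ℤ) : decide (Odd (n + 1)) = !decide (Odd n) := by
  rw [← decide_not, decide_eq_decide, Int.not_odd_iff_even, Int.odd_add]
  simp

theorem decide_odd_sub_one (n : ℤ) : decide (Odd (n - 1)) = !decide (Odd n) := by
  rw [← Bool.not_not (decide (Odd (n - 1))), ← decide_odd_add_one, sub_add_cancel]

theorem exists_limit_of_two_pow_dvd {A : ℕ → ℤ} (hA : ∀ k, (2 : ℤ) ^ (k + 1) ∣ A (k + 1) - A k) :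
    ∃ a : ℤ_[2], ∀ k, (2 : ℤ_[2]) ^ (k + 1) ∣ A k - a := by
  have hmem : ∀ (n : ℕ) (x y : ℤ_[2]),
      x ≡ y [SMOD (IsLocalRing.maximalIdeal ℤ_[2] ^ n • ⊤ : Submodule ℤ_[2] ℤ_[2])] ↔
        (2 : ℤ_[2]) ^ n ∣ x - y := by
    intro n x y
    rw [SModEq.sub_mem, PadicInt.maximalIdeal_eq_span_p, Ideal.span_singleton_pow]
    simp [Ideal.mem_span_singleton]
  have hstep : ∀ k, (2 : ℤ_[2]) ^ (k + 1) ∣ A (k + 1) - A k := by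
    intro k
    have := (two_pow_dvd_intCast_iff (k + 1) _).2 (hA k)
    push_cast at this
    exact this
  have hle : ∀ m n, m ≤ n → (2 : ℤ_[2]) ^ m ∣ A m - A n := by
    intro m n hmn
    induction n, hmn using Nat.le_induction with
    | base => simp
    | succ n hmn ih =>
      have := dvd_sub ih ((pow_dvd_pow 2 (by omega)).trans (hstep n))
      convert this using 1
      ring
  obtain ⟨a, ha⟩ := IsPrecomplete.prec (I := IsLocalRing.maximalIdeal ℤ_[2]) (M := ℤ_[2])
    inferInstance (f := fun k => (A k : ℤ_[2])) fun {m n} hmn => (hmem m _ _).2 (hle m n hmn)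
  refine ⟨a, fun k => ?_⟩
  have := dvd_sub ((hmem (k + 1) _ _).1 (ha (k + 1))) (hstep k)
  convert this using 1
  ring

/-- Sequences that have alternating brackets at the odd positions, and whose even positions have
this property again once they are numbered from `evenCenter`, are paperfolding sequences. The
centre is the 2-adic limit of the origins of the successive numberings. -/
theorem exists_isPaperfolding_of_renormalizable {G : (ℤ → Bool) → Prop}
    (hG : ∀ u, G u → (∀ i, u (evenCenter u + 1 + 2 * i) = decide (Odd i)) ∧
      G fun m => u (evenCenter u + 2 * m)) {u : ℤ → Bool} (hu : G u) :
    ∃ a, IsPaperfolding a u := by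
  obtain ⟨A, hA0, hA⟩ : ∃ A : ℕ → ℤ, A 0 = 0 ∧
      ∀ k, A (k + 1) = A k + 2 ^ k * evenCenter fun m => u (A k + 2 ^ k * m) :=
    ⟨fun k => Nat.rec 0 (fun k A => A + 2 ^ k * evenCenter fun m => u (A + 2 ^ k * m)) k,
      rfl, fun _ => rfl⟩
  have hGk : ∀ k, G fun m => u (A k + 2 ^ k * m) := by
    intro k
    induction k with
    | zero => simpa [hA0] using hu
    | succ k ih =>
      convert (hG _ ih).2 using 3 with m
      rw [hA]
      ring
  obtain ⟨a, ha⟩ := exists_limit_of_two_pow_dvd (A := A) fun k => by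
    rw [hA, add_sub_cancel_left, pow_succ]
    apply mul_dvd_mul_left
    unfold evenCenter
    split_ifs <;> simp
  refine ⟨a, fun k i x hx => ?_⟩
  have h : (2 : ℤ) ^ (k + 2) ∣ x - (A (k + 1) + 2 ^ k * (2 * i + 1)) := by
    rw [← two_pow_dvd_intCast_iff]
    have := dvd_sub hx (ha (k + 1))
    convert this using 1
    push_cast
    ring
  obtain ⟨w, hw⟩ := h
  have := (hG _ (hGk k)).1 (i + 2 * w)
  rw [show x = A k + 2 ^ k * ((evenCenter fun m => u (A k + 2 ^ k * m)) + 1 + 2 * (i + 2 * w)) by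
    rw [pow_add, hA] at hw
    linear_combination hw, this]
  simp [Int.odd_add]

/-! ### The cellular rules -/

/-- The part of the state of a cell that belongs to one of the two directions. For the horizontal
direction, in the cell where a column meets a row of rank `k`, it consists of
* `rankZero`: whether the column has rank `0`;
* `bit`: the bracket of the column;
* `phase`: the number modulo `4` of columns of rank at least `k` passed by the row up to this cell,
  so that the phases are `1`, `2` inside a pair of brackets of rank `k`, before and after its middle,
  and `3`, `0` between two such pairs, before and after the middle of the gap;
* `half`: a bit that the row sets at the columns of rank `k - 1` (a half-step), and that is free to
  change at the columns of rank at least `k`. -/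
structure Strand where
  rankZero : Bool
  bit : Bool
  phase : ZMod 4
  half : Bool
deriving Fintype

/-- The state of a cell: its two strands, and the comparison of the rank of its column with the rank
of its row. -/
structure Cell where
  hor : Strand
  ver : Strand
  cmp : Ordering
deriving Fintype

def Cell.swap (c : Cell) : Cell := ⟨c.ver, c.hor, c.cmp.swap⟩

/-- The configuration with the two coordinates exchanged. -/
def transpose (c : ℤ → ℤ → Cell) (x y : ℤ) : Cell := (c y x).swap

/-- The change of the phase of a row from a cell `c` to its right neighbor `c'`. The phase advances at
the columns whose rank is at least that of the row: the columns of the same rank carry the brackets,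
opening and closing in turn, and those of higher rank lie in the middles. At a column of lower rank
the phase is kept; there the row is, seen from the column, in the middle of a pair (vertical phase
`2`) if its rank exceeds that of the column by `1`, and in the middle of a gap (vertical phase `0`)
otherwise. -/
def PhaseStep (c c' : Cell) : Prop :=
  match c'.cmp with
  | .eq => (c.hor.phase = 0 ∧ c'.hor.phase = 1 ∧ c'.hor.bit = false) ∨
      (c.hor.phase = 2 ∧ c'.hor.phase = 3 ∧ c'.hor.bit = true)
  | .gt => (c.hor.phase = 1 ∧ c'.hor.phase = 2) ∨ (c.hor.phase = 3 ∧ c'.hor.phase = 0)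
  | .lt => c'.hor.phase = c.hor.phase ∧ (c'.ver.phase = 2 ∨ c'.ver.phase = 0)

/-- The change of the half-step bit of a row from a cell `c` to its right neighbor `c'`. It is set at
each column whose rank is one less than that of the row, and it must have been reset before. Columns
of still lower rank leave it unchanged, so that a column of rank at least that of the row comes
between any two half-steps. -/
def HalfStep (c c' : Cell) : Prop :=
  c'.cmp = .lt → (c'.ver.phase = 2 → c.hor.half = false ∧ c'.hor.half = true) ∧
    (c'.ver.phase = 0 → c'.hor.half = c.hor.half)

/-- The rows of the configuration `c` obey the local rules, the columns have the brackets `u`, and the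
columns and rows of rank `0` are those with odd coordinates. The half-step rule is not required of
the rows of rank `0`: after a renormalization these rows still have half-steps at columns that have
been removed. -/
structure RowRule (u : ℤ → Bool) (c : ℤ → ℤ → Cell) : Prop where
  bit : ∀ x y, (c x y).hor.bit = u x
  cmp : ∀ x y, Odd x → (c x y).cmp = if Odd y then .eq else .lt
  phase : ∀ x y, PhaseStep (c (x - 1) y) (c x y)
  half : ∀ x y, Even y → HalfStep (c (x - 1) y) (c x y)

section RowRule

variable {u v : ℤ → Bool} {c : ℤ → ℤ → Cell}

theorem RowRule.cmp_eq_lt (h : RowRule u c) {x y : ℤ} (hx : Odd x) (hy : Even y) :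
    (c x y).cmp = .lt := by
  rw [h.cmp x y hx, if_neg (Int.not_odd_iff_even.2 hy)]

theorem RowRule.of_cmp_lt (h : RowRule u c) {x y : ℤ} (hc : (c x y).cmp = .lt) :
    (c x y).hor.phase = (c (x - 1) y).hor.phase ∧
      ((c x y).ver.phase = 2 ∨ (c x y).ver.phase = 0) := by
  simpa [PhaseStep, hc] using h.phase x y

theorem RowRule.of_cmp_gt (h : RowRule u c) {x y : ℤ} (hc : (c x y).cmp = .gt) :
    ((c (x - 1) y).hor.phase = 1 ∧ (c x y).hor.phase = 2) ∨
      ((c (x - 1) y).hor.phase = 3 ∧ (c x y).hor.phase = 0) := by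
  simpa [PhaseStep, hc] using h.phase x y

theorem RowRule.of_cmp_eq (h : RowRule u c) {x y : ℤ} (hc : (c x y).cmp = .eq) :
    ((c (x - 1) y).hor.phase = 0 ∧ (c x y).hor.phase = 1 ∧ u x = false) ∨
      ((c (x - 1) y).hor.phase = 2 ∧ (c x y).hor.phase = 3 ∧ u x = true) := by
  simpa [PhaseStep, hc, h.bit] using h.phase x y

theorem PhaseStep.congr_left {c d e : Cell} (h : c.hor.phase = d.hor.phase) (hc : PhaseStep c e) :
    PhaseStep d e := by
  unfold PhaseStep at *
  rwa [← h]

theorem HalfStep.congr_left {c d e : Cell} (h : c.hor.half = d.hor.half) (hc : HalfStep c e) :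
    HalfStep d e := by
  unfold HalfStep at *
  rwa [← h]

theorem cmp_eq_of_transpose {x y : ℤ} {o : Ordering}
    (h : (transpose c y x).cmp = o) : (c x y).cmp = o.swap := by
  rw [← h]
  simp [transpose, Cell.swap]

theorem transpose_transpose (c : ℤ → ℤ → Cell) : transpose (transpose c) = c := by
  funext x y
  simp [transpose, Cell.swap]

/-- Along a row of rank `0` the columns of positive rank are, in turn, inside and outside the pairs of
brackets of rank `0`. -/
theorem RowRule.phase_even_odd (h : RowRule u c) (h' : RowRule v (transpose c)) {x y : ℤ}
    (hx : Even x) (hy : Odd y) : (c x y).hor.phase = if u (x - 1) then 0 else 2 := by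
  have hgt : (c x y).cmp = .gt := cmp_eq_of_transpose (h'.cmp_eq_lt hy hx)
  have heq : (c (x - 1) y).cmp = .eq := by
    rw [h.cmp _ _ (hx.sub_odd odd_one), if_pos hy]
  have h1 := h.of_cmp_gt hgt
  rcases h.of_cmp_eq heq with ⟨-, h2, h3⟩ | ⟨-, h2, h3⟩ <;> rw [h2] at h1 <;> rw [h3] <;>
    revert h1 <;> generalize (c x y).hor.phase = p <;> revert p <;> decide

theorem RowRule.alternate (h : RowRule u c) (h' : RowRule v (transpose c)) {x : ℤ} (hx : Even x) :
    u (x + 1) = !u (x - 1) := by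
  have h1 := h.phase_even_odd h' hx odd_one
  have heq : (c (x + 1) 1).cmp = .eq := by
    rw [h.cmp _ _ (hx.add_odd odd_one), if_pos odd_one]
  have h2 := h.of_cmp_eq heq
  rw [add_sub_cancel_right, h1] at h2
  cases hu : u (x - 1) <;> rw [hu] at h2
  · rcases h2 with ⟨h2, -, -⟩ | ⟨-, -, h2⟩
    · exact absurd h2 (by decide)
    · simpa using h2
  · rcases h2 with ⟨-, -, h2⟩ | ⟨h2, -, -⟩
    · simpa using h2
    · exact absurd h2 (by decide)

theorem even_evenCenter (u : ℤ → Bool) : Even (evenCenter u) := by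
  unfold evenCenter
  split_ifs <;> decide

theorem RowRule.alternating (h : RowRule u c) (h' : RowRule v (transpose c)) (i : ℤ) :
    u (evenCenter u + 1 + 2 * i) = decide (Odd i) := by
  have hstep : ∀ j : ℤ, u (evenCenter u + 1 + 2 * (j + 1)) = !u (evenCenter u + 1 + 2 * j) := by
    intro j
    have := h.alternate h' (x := evenCenter u + 2 * (j + 1))
      ((even_evenCenter u).add (even_two_mul _))
    rw [show evenCenter u + 1 + 2 * (j + 1) = evenCenter u + 2 * (j + 1) + 1 by ring, this]
    congr 2
    ring
  induction i using Int.induction_on with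
  | zero =>
    have := h.alternate h' (x := 2) even_two
    norm_num at this
    cases hu : u 1 <;> simp [evenCenter, hu, this]
  | succ i ih =>
    rw [hstep, ih, decide_odd_add_one]
  | pred i ih =>
    have := hstep (-i - 1)
    rw [sub_add_cancel, ih] at this
    rw [← Bool.not_not (u _), ← this, decide_odd_sub_one]

/-- On a column inside the pairs of brackets of rank `0`, each row of rank `0` makes a half-step,
which another step must precede. -/
theorem RowRule.cmp_ne_gt (h : RowRule u c) (h' : RowRule v (transpose c)) {x y : ℤ}
    (hx : Even x) (hy : Even y) (hu : u (x - 1) = false) : (c x y).cmp ≠ .gt := by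
  intro hgt
  have hodd : ∀ z, Odd z →
      (c x (z - 1)).ver.half = false ∧ (c x z).ver.half = true := by
    intro z hz
    have h1 := h.phase_even_odd h' hx hz
    rw [hu] at h1
    exact (h'.half z x hx (h'.cmp_eq_lt hz hx)).1 h1
  have h2 := (hodd (y - 1) (hy.sub_odd odd_one)).2
  have h3 := (hodd (y + 1) (hy.add_odd odd_one)).1
  rw [add_sub_cancel_right] at h3
  have h4 : (transpose c y x).cmp = .lt := by simp [transpose, Cell.swap, hgt]
  have h5 := h'.half y x hx h4
  have h6 := (h'.of_cmp_lt h4).2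
  simp only [transpose, Cell.swap] at h5 h6
  rw [h2, h3] at h5
  rcases h6 with h6 | h6
  · exact absurd (h5.1 h6).1 (by decide)
  · exact absurd (h5.2 h6) (by decide)

theorem RowRule.cmp_ne_lt (h : RowRule u c) (h' : RowRule v (transpose c)) {x y : ℤ}
    (hx : Even x) (hy : Even y) (hv : v (y - 1) = false) : (c x y).cmp ≠ .lt := by
  have := h'.cmp_ne_gt (by rwa [transpose_transpose]) hy hx hv
  intro hlt
  simp [transpose, Cell.swap, hlt] at this

/-- The columns of positive rank inside the pairs of brackets of rank `0` behave towards the rows of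
positive rank as columns of rank `0` towards all rows: they have rank `1`. -/
theorem RowRule.cmp_even (h : RowRule u c) (h' : RowRule v (transpose c)) {x y : ℤ}
    (hx : Even x) (hy : Even y) (hu : u (x - 1) = false) :
    (c x y).cmp = if v (y - 1) then .lt else .eq := by
  have hng : ∀ z, Even z → (c x z).cmp ≠ .gt := fun z hz => h.cmp_ne_gt h' hx hz hu
  have heq : ∀ z, Even z → v (z - 1) = false → (c x z).cmp = .eq := by
    intro z hz hvz
    have h1 := hng z hz
    have h2 := h.cmp_ne_lt h' hx hz hvz
    cases hcz : (c x z).cmp <;> simp_all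
  cases hv : v (y - 1)
  · simpa using heq y hy hv
  · -- The phase of the column has just been made odd by the row `y - 2`, so that this is not the
    -- time for a bracket of the rank of the column.
    have hne : (c x y).cmp ≠ .eq := by
      intro hc
      have h1 : v (y - 2 - 1) = false := by
        have := h'.alternate (by rwa [transpose_transpose]) (x := y - 2) (hy.sub even_two)
        rw [show y - 2 + 1 = y - 1 by ring, hv] at this
        simpa using this
      have h2 : (transpose c (y - 2) x).cmp = .eq := by
        simp [transpose, Cell.swap, heq (y - 2) (hy.sub even_two) h1]
      have h3 : (transpose c (y - 1) x).cmp = .lt :=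
        h'.cmp_eq_lt (hy.sub_odd odd_one) hx
      have h4 : (transpose c y x).cmp = .eq := by
        simp [transpose, Cell.swap, hc]
      have h5 := (h'.of_cmp_lt h3).1
      rw [show y - 1 - 1 = y - 2 by ring] at h5
      have h6 := h'.of_cmp_eq h2
      have h7 := h'.of_cmp_eq h4
      rw [h5] at h7
      rcases h6 with ⟨-, h6, -⟩ | ⟨-, h6, -⟩ <;> rw [h6] at h7 <;>
        rcases h7 with ⟨h7, -⟩ | ⟨h7, -⟩ <;> exact absurd h7 (by decide)
    have h1 := hng y hy
    cases hcz : (c x y).cmp <;> simp_all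

/-- The rules are inherited by the columns and rows of positive rank, numbered from `evenCenter` so
that those of rank `1` become the odd ones. -/
theorem RowRule.renormalize (h : RowRule u c) (h' : RowRule v (transpose c)) :
    RowRule (fun m => u (evenCenter u + 2 * m))
      fun m n => c (evenCenter u + 2 * m) (evenCenter v + 2 * n) := by
  have heven : ∀ (w : ℤ → Bool) (m : ℤ), Even (evenCenter w + 2 * m) :=
    fun w m => (even_evenCenter w).add (even_two_mul m)
  have hv : ∀ n, v (evenCenter v + 2 * n - 1) = !decide (Odd n) := by
    intro n
    have := h'.alternating (by rwa [transpose_transpose]) (n - 1)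
    rw [show evenCenter v + 1 + 2 * (n - 1) = evenCenter v + 2 * n - 1 by ring] at this
    rw [this, decide_odd_sub_one]
  have hlt : ∀ m n, (c (evenCenter u + 2 * m - 1) (evenCenter v + 2 * n)).cmp = .lt := by
    intro m n
    exact h.cmp_eq_lt ((heven u m).sub_odd odd_one) (heven v n)
  have hsub : ∀ m : ℤ, evenCenter u + 2 * (m - 1) = evenCenter u + 2 * m - 1 - 1 :=
    fun m => by ring
  refine ⟨fun m n => h.bit _ _, fun m n hm => ?_, fun m n => ?_, fun m n hn => ?_⟩
  · rw [h.cmp_even h' (heven u m) (heven v n), hv]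
    · by_cases hn : Odd n <;> simp [hn]
    · have := h.alternating h' (m - 1)
      rw [show evenCenter u + 1 + 2 * (m - 1) = evenCenter u + 2 * m - 1 by ring] at this
      rw [this, decide_odd_sub_one]
      simpa using hm
  · rw [hsub]
    exact (h.phase _ _).congr_left (h.of_cmp_lt (hlt m n)).1
  · rw [hsub]
    refine (h.half _ _ (heven v n)).congr_left ((h.half _ _ (heven v n) (hlt m n)).2 ?_)
    have := h'.phase_even_odd (by rwa [transpose_transpose]) (x := evenCenter v + 2 * n)
      (y := evenCenter u + 2 * m - 1) (heven v n) ((heven u m).sub_odd odd_one)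
    rw [hv] at this
    simpa [transpose, Cell.swap, hn] using this

/-- Soundness of the rules: since they are inherited at all ranks, they force the brackets of the
columns to form a paperfolding sequence. -/
theorem RowRule.exists_isPaperfolding (h : RowRule u c) (h' : RowRule v (transpose c)) :
    ∃ a, IsPaperfolding a u := by
  refine exists_isPaperfolding_of_renormalizable
    (G := fun u => ∃ v c, RowRule u c ∧ RowRule v (transpose c)) ?_ ⟨v, c, h, h'⟩
  rintro u ⟨v, c, h, h'⟩
  have h'' : RowRule u (transpose (transpose c)) := by rwa [transpose_transpose]
  exact ⟨h.alternating h', _, _, h.renormalize h', h'.renormalize h''⟩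

end RowRule

/-! ### Phases of a paperfolding sequence -/

theorem sub_one_ediv_of_dvd {d n : ℤ} (hd : 0 < d) (h : d ∣ n) : (n - 1) / d = n / d - 1 := by
  obtain ⟨t, rfl⟩ := h
  rw [Int.mul_ediv_cancel_left _ hd.ne', show d * t - 1 = (d - 1) + d * (t - 1) by ring,
    Int.add_mul_ediv_left _ _ hd.ne', Int.ediv_eq_zero_of_lt (by omega) (by omega), zero_add]

theorem sub_one_ediv_of_not_dvd {d n : ℤ} (hd : 0 < d) (h : ¬ d ∣ n) : (n - 1) / d = n / d := by
  have h1 := Int.emod_nonneg n hd.ne'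
  have h2 := Int.emod_lt_of_pos n hd
  have h3 : n % d ≠ 0 := fun h0 => h (Int.dvd_of_emod_eq_zero h0)
  have h4 := Int.emod_add_mul_ediv n d
  rw [show n - 1 = (n % d - 1) + d * (n / d) by linarith, Int.add_mul_ediv_left _ _ hd.ne',
    Int.ediv_eq_zero_of_lt (by omega) (by omega), zero_add]

/-- `r` assigns ranks to the positions of `u`, and `Q x s` is the phase just after the position `x`
along a row of rank `s`; ranks may be infinite. The phase of a row of rank `s` is kept at positions
of lower rank, steps from `0` to `1` or from `2` to `3` at positions of rank `s`, according to the
bracket, from `1` to `2` at those of rank `s + 1`, and from `3` to `0` at those of larger rank. -/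
structure PhaseSystem (u : ℤ → Bool) (r : ℤ → ℕ∞) (Q : ℤ → ℕ∞ → ZMod 4) : Prop where
  lt : ∀ x s, r x < s → Q x s = Q (x - 1) s
  eq : ∀ x, (Q (x - 1) (r x) = 0 ∧ Q x (r x) = 1 ∧ u x = false) ∨
    (Q (x - 1) (r x) = 2 ∧ Q x (r x) = 3 ∧ u x = true)
  succ : ∀ x s, r x = s + 1 → s < r x → Q (x - 1) s = 1 ∧ Q x s = 2
  gt : ∀ x s, s + 1 < r x → Q (x - 1) s = 3 ∧ Q x s = 0

/-- The quotient of `x - A` by `2 ^ s`, where `A` is an integer approximating the centre `a`, grows by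
one exactly at the positions `x` of rank at least `s`. Modulo `4`, its value there tells whether the
rank is `s`, `s + 1` or larger, and in the first case gives the bracket. -/
theorem phase_of_rank {a : ℤ_[2]} {u : ℤ → Bool} (hu : IsPaperfolding a u) {A : ℤ} {s : ℕ}
    (hA : (2 : ℤ_[2]) ^ (s + 2) ∣ A - a) (x : ℤ) :
    (¬ (2 : ℤ_[2]) ^ s ∣ x - a → (x - 1 - A) / 2 ^ s = (x - A) / 2 ^ s) ∧
    ((2 : ℤ_[2]) ^ s ∣ x - a → ∃ t : ℤ, (x - A) / 2 ^ s = t ∧ (x - 1 - A) / 2 ^ s = t - 1 ∧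
      (∀ j ≤ 2, (2 : ℤ_[2]) ^ (s + j) ∣ x - a ↔ (2 : ℤ) ^ j ∣ t) ∧
      ∀ i, t = 2 * i + 1 → u x = decide (Odd i)) := by
  have hpos : (0 : ℤ) < 2 ^ s := by positivity
  have hiff : ∀ j ≤ 2, (2 : ℤ_[2]) ^ (s + j) ∣ x - a ↔ (2 : ℤ) ^ (s + j) ∣ x - A := by
    intro j hj
    rw [← two_pow_dvd_intCast_iff, ← dvd_iff_dvd_of_dvd_sub]
    have : (2 : ℤ_[2]) ^ (s + j) ∣ A - a := (pow_dvd_pow 2 (by omega)).trans hA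
    rw [← dvd_neg]
    convert this using 1
    push_cast
    ring
  have h0 := hiff 0 (by omega)
  rw [add_zero] at h0
  rw [show x - 1 - A = x - A - 1 by ring]
  constructor
  · intro h
    exact sub_one_ediv_of_not_dvd hpos (mt h0.2 h)
  · intro h
    rw [sub_one_ediv_of_dvd hpos (h0.1 h)]
    obtain ⟨t, ht⟩ := h0.1 h
    refine ⟨t, by rw [ht, Int.mul_ediv_cancel_left _ hpos.ne'],
      by rw [ht, Int.mul_ediv_cancel_left _ hpos.ne'], fun j hj => ?_, fun i hi => ?_⟩
    · rw [hiff j hj, ht, pow_add]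
      exact mul_dvd_mul_iff_left hpos.ne'
    · apply hu s i x
      have : (x : ℤ_[2]) - (a + 2 ^ s * (2 * i + 1)) = A - a := by
        have := congrArg (Int.cast (R := ℤ_[2])) ht
        rw [hi] at this
        push_cast at this
        linear_combination this
      rwa [this]

theorem IsPaperfolding.exists_phaseSystem {a : ℤ_[2]} {u : ℤ → Bool} (hu : IsPaperfolding a u) :
    ∃ r Q, PhaseSystem u r Q ∧ ∃ e : ℤ, ∀ x, r x = 0 ↔ Odd (x - e) := by
  classical
  choose A hA using fun s : ℕ => exists_int_two_pow_dvd_sub a (s + 2)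
  let r : ℤ → ℕ∞ := fun x => emultiplicity (2 : ℤ_[2]) (x - a)
  have hr : ∀ x (k : ℕ), (k : ℕ∞) ≤ r x ↔ (2 : ℤ_[2]) ^ k ∣ x - a :=
    fun x k => pow_dvd_iff_le_emultiplicity.symm
  have hrtop : ∀ x, r x = ⊤ ↔ (x : ℤ_[2]) = a := by
    intro x
    rw [emultiplicity_eq_top, ← sub_eq_zero]
    refine ⟨fun h => ?_, fun h => ?_⟩
    · by_contra hne
      exact h (FiniteMultiplicity.of_prime_left
        (by exact_mod_cast PadicInt.prime_p (p := 2)) hne)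
    · rw [h]
      exact fun hf => hf.ne_zero rfl
  -- A row of infinite rank changes its phase only at the column of infinite rank, if it exists.
  let Q : ℤ → ℕ∞ → ZMod 4 := fun x s =>
    if s = ⊤ then
      (if ∃ z : ℤ, (z : ℤ_[2]) = a ∧ u z = true then 2 else 0) +
        (if ∃ z : ℤ, (z : ℤ_[2]) = a ∧ z ≤ x then 1 else 0)
    else (((x - A s.toNat) / 2 ^ s.toNat : ℤ) : ZMod 4)
  have hQ : ∀ x (s : ℕ), Q x s = (((x - A s) / 2 ^ s : ℤ) : ZMod 4) := by
    intro x s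
    simp [Q]
  have hmod4 : ∀ t : ℤ, ∀ j : ℤ, ((4 * j + t : ℤ) : ZMod 4) = t := by
    intro t j
    have : (4 : ZMod 4) = 0 := rfl
    push_cast
    rw [this]
    ring
  refine ⟨r, Q, ⟨fun x s h => ?_, fun x => ?_, fun x s h hs => ?_, fun x s h => ?_⟩, A 0, fun x => ?_⟩
  · induction s using ENat.recTopCoe with
    | top =>
      have hx : (x : ℤ_[2]) ≠ a := fun hx => h.ne ((hrtop x).2 hx)
      have : ∀ z : ℤ, ((z : ℤ_[2]) = a ∧ z ≤ x) ↔ ((z : ℤ_[2]) = a ∧ z ≤ x - 1) := by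
        intro z
        refine and_congr_right fun hz => ?_
        have : z ≠ x := by
          rintro rfl
          exact hx hz
        omega
      simp [Q, this]
    | coe s =>
      rw [hQ, hQ, (phase_of_rank hu (hA s) x).1 (fun h' => h.not_ge ((hr x s).2 h'))]
  · rcases eq_or_ne (r x) ⊤ with h | h
    · have hx := (hrtop x).1 h
      have hz : ∀ z : ℤ, (z : ℤ_[2]) = a ↔ z = x := by
        intro z
        rw [← hx]
        exact Int.cast_inj
      rw [h]
      cases hux : u x
      · simp [Q, hz, hux]
      · simp [Q, hz, hux]
        decide
    · obtain ⟨s, hs⟩ := ENat.ne_top_iff_exists.1 h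
      obtain ⟨t, h1, h2, h3, h4⟩ := (phase_of_rank hu (hA s) x).2 ((hr x s).1 hs.le)
      rw [← hs, hQ, hQ, h1, h2]
      have hodd : ¬ (2 : ℤ) ∣ t := by
        rw [← pow_one (2 : ℤ), ← h3 1 (by omega), ← hr, ← hs]
        exact_mod_cast (by omega : ¬ s + 1 ≤ s)
      obtain ⟨i, rfl⟩ : Odd t := by
        rwa [← Int.not_even_iff_odd, even_iff_two_dvd]
      rw [h4 i rfl]
      rcases Int.even_or_odd' i with ⟨j, rfl | rfl⟩
      · left
        rw [show 2 * (2 * j) + 1 - 1 = 4 * j + 0 by ring, show 2 * (2 * j) + 1 = 4 * j + 1 by ring,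
          hmod4, hmod4]
        simp
      · right
        rw [show 2 * (2 * j + 1) + 1 - 1 = 4 * j + 2 by ring,
          show 2 * (2 * j + 1) + 1 = 4 * j + 3 by ring, hmod4, hmod4]
        simp
  · lift s to ℕ using (hs.trans_le le_top).ne
    obtain ⟨t, h1, h2, h3, -⟩ := (phase_of_rank hu (hA s) x).2 ((hr x s).1 hs.le)
    rw [hQ, hQ, h1, h2]
    have heven : (2 : ℤ) ^ 1 ∣ t := by
      rw [← h3 1 (by omega), ← hr, h]
      rfl
    have hodd : ¬ (2 : ℤ) ^ 2 ∣ t := by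
      rw [← h3 2 (by omega), ← hr, h]
      exact_mod_cast (by omega : ¬ s + 2 ≤ s + 1)
    obtain ⟨j, rfl⟩ : ∃ j, t = 4 * j + 2 := ⟨t / 4, by omega⟩
    rw [show 4 * j + 2 - 1 = 4 * j + 1 by ring, hmod4, hmod4]
    simp
  · have hs : s < r x := lt_of_le_of_lt le_self_add h
    lift s to ℕ using (hs.trans_le le_top).ne
    obtain ⟨t, h1, h2, h3, -⟩ := (phase_of_rank hu (hA s) x).2 ((hr x s).1 hs.le)
    rw [hQ, hQ, h1, h2]
    have heven : (2 : ℤ) ^ 2 ∣ t := by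
      rw [← h3 2 (by omega), ← hr]
      exact_mod_cast Order.add_one_le_of_lt h
    obtain ⟨j, rfl⟩ : ∃ j, t = 4 * j := ⟨t / 4, by omega⟩
    rw [show 4 * j - 1 = 4 * (j - 1) + 3 by ring, hmod4, ← add_zero (4 * j), hmod4]
    simp
  · obtain ⟨t, h1, -, h3, -⟩ := (phase_of_rank hu (hA 0) x).2 (by simp)
    have h4 := h3 1 (by omega)
    simp only [pow_zero, Int.ediv_one, pow_one] at h1 h4
    rw [h1, ← Int.not_even_iff_odd, even_iff_two_dvd, ← h4, ← hr, not_le]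
    exact_mod_cast (Order.lt_one_iff).symm

section RankCell

variable {u v : ℤ → Bool} {r s : ℤ → ℕ∞} {Q R : ℤ → ℕ∞ → ZMod 4}

open Classical in
/-- The horizontal strand of the cells at the column `x` and at a row of rank `s`. The half-steps
for rank `k + 1` are the steps for rank `k`. -/
noncomputable def rankStrand (u : ℤ → Bool) (r : ℤ → ℕ∞) (Q : ℤ → ℕ∞ → ZMod 4) (x : ℤ) (s : ℕ∞) :
    Strand where
  rankZero := decide (r x = 0)
  bit := u x
  phase := Q x s
  half := decide (∃ k : ℕ, s = k + 1 ∧ (Q x k = 1 ∨ Q x k = 3))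

open Classical in
/-- The cell where a column and a row of known ranks meet, for columns with brackets `u`, ranks `r`
and phases `Q`, and rows with brackets `v`, ranks `s` and phases `R`. -/
noncomputable def rankCell (u v : ℤ → Bool) (r s : ℤ → ℕ∞) (Q R : ℤ → ℕ∞ → ZMod 4) (x y : ℤ) :
    Cell where
  hor := rankStrand u r Q x (s y)
  ver := rankStrand v s R y (r x)
  cmp := if r x < s y then .lt else if r x = s y then .eq else .gt

theorem transpose_rankCell : transpose (rankCell u v r s Q R) = rankCell v u s r R Q := by
  funext x y
  simp only [transpose, rankCell, Cell.swap, Cell.mk.injEq, true_and]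
  rcases lt_trichotomy (r y) (s x) with h | h | h
  · simp [h, h.not_gt, h.ne']
  · simp [h]
  · simp [h, h.not_gt, h.ne']

theorem phaseStep_rankCell (hQ : PhaseSystem u r Q) (hR : PhaseSystem v s R) (x y : ℤ) :
    PhaseStep (rankCell u v r s Q R (x - 1) y) (rankCell u v r s Q R x y) := by
  rcases lt_trichotomy (r x) (s y) with h | h | h
  · simp only [PhaseStep, rankCell, if_pos h, rankStrand]
    refine ⟨hQ.lt x _ h, ?_⟩
    rcases (Order.add_one_le_of_lt h).eq_or_lt with h' | h'
    · exact Or.inl (hR.succ y _ h'.symm h).2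
    · exact Or.inr (hR.gt y _ h').2
  · simpa [PhaseStep, rankCell, h, rankStrand] using hQ.eq x
  · simp only [PhaseStep, rankCell, if_neg h.not_gt, if_neg h.ne', rankStrand]
    rcases (Order.add_one_le_of_lt h).eq_or_lt with h' | h'
    · exact Or.inl (hQ.succ x _ h'.symm h)
    · exact Or.inr (hQ.gt x _ h')

theorem halfStep_rankCell (hQ : PhaseSystem u r Q) (hR : PhaseSystem v s R) (x y : ℤ) :
    HalfStep (rankCell u v r s Q R (x - 1) y) (rankCell u v r s Q R x y) := by
  intro hlt
  have h : r x < s y := by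
    by_contra hge
    simp only [rankCell, if_neg hge] at hlt
    split_ifs at hlt
  simp only [rankCell, rankStrand]
  rcases (Order.add_one_le_of_lt h).eq_or_lt with h' | h'
  · rw [(hR.succ y _ h'.symm h).2]
    refine ⟨fun _ => ?_, fun h0 => absurd h0 (by decide)⟩
    obtain ⟨k, hk⟩ := ENat.ne_top_iff_exists.1 (h.trans_le le_top).ne
    have hj : ∀ j : ℕ, s y = j + 1 ↔ j = k := by
      intro j
      rw [← h', ← hk]
      norm_cast
      omega
    have := hQ.eq x
    rw [← hk] at this
    simp only [hj, exists_eq_left]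
    rcases this with ⟨h1, h2, -⟩ | ⟨h1, h2, -⟩ <;> rw [h1, h2] <;> decide
  · rw [(hR.gt y _ h').2]
    refine ⟨fun h0 => absurd h0 (by decide), fun _ => ?_⟩
    rw [decide_eq_decide]
    refine exists_congr fun k => and_congr_right fun hk => ?_
    rw [hQ.lt x k]
    rw [hk] at h'
    exact lt_of_add_lt_add_right h'

end RankCell

/-! ### From cellular rules to palettes -/

/-- The configurations of cells in which horizontal neighbors are related by `H` and vertical
neighbors by `V`. -/
def validConfigs {A : Type} (H V : A → A → Prop) : Set (ℤ → ℤ → A) :=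
  {c | ∀ x y, H (c (x - 1) y) (c x y) ∧ V (c x (y - 1)) (c x y)}

/-- The tiling that writes the state of the cell `(x, y)` on the two edges leaving `(x, y)` upward
and to the right, with a tag telling the direction of the edge. -/
def ofCells {A : Type} (c : ℤ → ℤ → A) : Tiling (A ⊕ A)
  | .vert x y => .inl (c x y)
  | .horiz x y => .inr (c x y)

/-- The tiles whose left and bottom edges belong to one cell, related by `H` to the cell of the right
edge and by `V` to that of the top edge. The tags force vertical edges to be colored in the left
summand and horizontal ones in the right summand. -/
def tilePalette {A : Type} (H V : A → A → Prop) : Set (Tile (A ⊕ A)) :=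
  {t | ∃ p q s, t = ⟨.inl p, .inl q, .inr p, .inr s⟩ ∧ H p q ∧ V p s}

/-- The crosses whose east and north edges belong to one cell, to which the cell of the west edge is
related by `H` and that of the south edge by `V`. -/
def crossPalette {A : Type} (H V : A → A → Prop) : Set (Cross (A ⊕ A)) :=
  {t | ∃ p q s, t = ⟨.inr q, .inr p, .inl s, .inl p⟩ ∧ H q p ∧ V s p}

theorem mem_paletteTilings_tilePalette_iff {A : Type} {H V : A → A → Prop} {T : Tiling (A ⊕ A)} :
    T ∈ paletteTilings (tilePalette H V) ↔ ∃ c ∈ validConfigs H V, T = ofCells c := by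
  constructor
  · intro hT
    choose p q s hpqs hH hV using hT
    simp only [Tiling.tileAt, Tile.mk.injEq] at hpqs
    refine ⟨p, fun x y => ⟨?_, ?_⟩, ?_⟩
    · have h1 := (hpqs (x - 1) y).2.1
      rw [sub_add_cancel, (hpqs x y).1] at h1
      rw [Sum.inl.inj h1]
      exact hH _ _
    · have h1 := (hpqs x (y - 1)).2.2.2
      rw [sub_add_cancel, (hpqs x y).2.2.1] at h1
      rw [Sum.inr.inj h1]
      exact hV _ _
    · ext e
      rcases e with ⟨x, y⟩ | ⟨x, y⟩
      · exact (hpqs x y).1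
      · exact (hpqs x y).2.2.1
  · rintro ⟨c, hc, rfl⟩ x y
    have h1 := (hc (x + 1) y).1
    have h2 := (hc x (y + 1)).2
    rw [add_sub_cancel_right] at h1 h2
    exact ⟨_, _, _, rfl, h1, h2⟩

theorem mem_crossPaletteTilings_crossPalette_iff {A : Type} {H V : A → A → Prop}
    {T : Tiling (A ⊕ A)} :
    T ∈ crossPaletteTilings (crossPalette H V) ↔ ∃ c ∈ validConfigs H V, T = ofCells c := by
  constructor
  · intro hT
    choose p q s hpqs hH hV using hT
    simp only [Tiling.crossAt, Cross.mk.injEq] at hpqs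
    refine ⟨p, fun x y => ⟨?_, ?_⟩, ?_⟩
    · have h1 := (hpqs x y).1
      rw [(hpqs (x - 1) y).2.1] at h1
      rw [Sum.inr.inj h1]
      exact hH _ _
    · have h1 := (hpqs x y).2.2.1
      rw [(hpqs x (y - 1)).2.2.2] at h1
      rw [Sum.inl.inj h1]
      exact hV _ _
    · ext e
      rcases e with ⟨x, y⟩ | ⟨x, y⟩
      · exact (hpqs x y).2.2.2
      · exact (hpqs x y).2.1
  · rintro ⟨c, hc, rfl⟩ x y
    exact ⟨_, _, _, rfl, (hc x y).1, (hc x y).2⟩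

/-! ### The local rule -/

/-- The rule relating a cell `c` to its right neighbor `c'`: the ranks of the columns are
alternately `0` and positive, the data of the row are constant along it, and the comparison mark is
the right one where the column has rank `0`. -/
structure HorizRule (c c' : Cell) : Prop where
  rankZero : c'.hor.rankZero = !c.hor.rankZero
  rankZero_row : c'.ver.rankZero = c.ver.rankZero
  bit_row : c'.ver.bit = c.ver.bit
  cmp : c'.hor.rankZero = true → c'.cmp = if c'.ver.rankZero then .eq else .lt
  phase : PhaseStep c c'
  half : HalfStep c c'

/-- The rule relating a cell to its upper neighbor: `HorizRule` with the coordinates exchanged. -/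
def VertRule (c c' : Cell) : Prop := HorizRule c.swap c'.swap

theorem eq_of_forall_sub_one_eq {A : Type} {f : ℤ → A} (h : ∀ x, f x = f (x - 1)) (x : ℤ) :
    f x = f 0 := by
  induction x using Int.induction_on with
  | zero => rfl
  | succ i ih => rw [h, add_sub_cancel_right, ih]
  | pred i ih => rw [← h, ih]

theorem exists_odd_sub_iff {f : ℤ → Bool} (h : ∀ x, f x = !f (x - 1)) :
    ∃ e : ℤ, ∀ x, f x = true ↔ Odd (x - e) := by
  have key : ∀ x, xor (f x) (decide (Odd x)) = f 0 := by
    intro x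
    have := eq_of_forall_sub_one_eq (f := fun x => xor (f x) (decide (Odd x)))
      (fun x => by
        rw [h x, decide_odd_sub_one]
        cases f (x - 1) <;> cases decide (Odd x) <;> rfl) x
    simpa using this
  cases h0 : f 0
  · refine ⟨0, fun x => ?_⟩
    have hx := key x
    rw [h0] at hx
    rw [sub_zero, ← decide_eq_true_iff (p := Odd x)]
    revert hx
    cases f x <;> cases decide (Odd x) <;> decide
  · refine ⟨1, fun x => ?_⟩
    have hx := key x
    rw [h0] at hx
    rw [← decide_eq_true_iff (p := Odd (x - 1)), decide_odd_sub_one]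
    revert hx
    cases f x <;> cases decide (Odd x) <;> decide

/-- The bracket of the edges of each color: the bracket of the column for vertical edges, that of
the row for horizontal ones. -/
def edgeBit : Cell ⊕ Cell → Bool := Sum.elim (fun c => c.hor.bit) fun c => c.ver.bit

/-- A configuration obeying the local rules, translated so that its rank `0` columns and rows become
the odd ones. -/
theorem rowRule_translate {u : ℤ → Bool} {c : ℤ → ℤ → Cell} {e e' : ℤ}
    (hu : ∀ x y, (c x y).hor.bit = u x)
    (he : ∀ x y, (c x y).hor.rankZero = true ↔ Odd (x - e))
    (he' : ∀ x y, (c x y).ver.rankZero = true ↔ Odd (y - e'))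
    (hc : ∀ x y, HorizRule (c (x - 1) y) (c x y)) :
    RowRule (fun x => u (e + x)) fun x y => c (e + x) (e' + y) := by
  have hsub : ∀ x, e + (x - 1) = e + x - 1 := fun x => by ring
  refine ⟨fun x y => hu _ _, fun x y hx => ?_, fun x y => ?_, fun x y _ => ?_⟩
  · rw [(hc _ _).cmp ((he _ _).2 (by simpa using hx))]
    congr 1
    rw [he' (e + x) (e' + y)]
    simp
  · rw [hsub]
    exact (hc _ _).phase
  · rw [hsub]
    exact (hc _ _).half

/-- Soundness of the rules, once the parities of the columns and rows of rank `0` are read off. -/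
theorem recolor_ofCells_mem {d₁ d₂ : Bool} {c : ℤ → ℤ → Cell}
    (hc : c ∈ validConfigs HorizRule VertRule) :
    (ofCells c).recolor edgeBit ∈ shiftsAndReflections d₁ d₂ := by
  have hH : ∀ x y, HorizRule (c (x - 1) y) (c x y) := fun x y => (hc x y).1
  have hV : ∀ x y, HorizRule (c x (y - 1)).swap (c x y).swap := fun x y => (hc x y).2
  have hu : ∀ x y, (c x y).hor.bit = (c x 0).hor.bit := fun x =>
    eq_of_forall_sub_one_eq fun y => (hV x y).bit_row
  have hv : ∀ x y, (c x y).ver.bit = (c 0 y).ver.bit := fun x y =>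
    eq_of_forall_sub_one_eq (f := fun x => (c x y).ver.bit) (fun x => (hH x y).bit_row) x
  have hux : ∀ x y, (c x y).hor.rankZero = (c x 0).hor.rankZero := fun x =>
    eq_of_forall_sub_one_eq fun y => (hV x y).rankZero_row
  have hvy : ∀ x y, (c x y).ver.rankZero = (c 0 y).ver.rankZero := fun x y =>
    eq_of_forall_sub_one_eq (f := fun x => (c x y).ver.rankZero) (fun x => (hH x y).rankZero_row) x
  obtain ⟨e, he⟩ := exists_odd_sub_iff (f := fun x => (c x 0).hor.rankZero)
    fun x => (hH x 0).rankZero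
  obtain ⟨e', he'⟩ := exists_odd_sub_iff (f := fun y => (c 0 y).ver.rankZero)
    fun y => (hV 0 y).rankZero
  have h1 := rowRule_translate hu (fun x y => by rw [hux]; exact he x)
    (fun x y => by rw [hvy]; exact he' y) hH
  have h2 : RowRule (fun y => (c 0 (e' + y)).ver.bit)
      (transpose fun x y => c (e + x) (e' + y)) :=
    rowRule_translate (c := transpose c) (fun y x => hv x y)
      (fun y x => by simpa only [transpose, Cell.swap, hvy x y] using he' y)
      (fun y x => by simpa only [transpose, Cell.swap, hux x y] using he x)
      (fun y x => hV x y)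
  obtain ⟨a, ha⟩ := h1.exists_isPaperfolding h2
  obtain ⟨b, hb⟩ := h2.exists_isPaperfolding (by rwa [transpose_transpose])
  refine mem_shiftsAndReflections_iff.2 ⟨_, _, ?_,
    ⟨_, IsPaperfolding.translate (u := fun x => (c x 0).hor.bit) ha⟩,
    ⟨_, IsPaperfolding.translate (u := fun y => (c 0 y).ver.bit) hb⟩⟩
  ext z
  rcases z with ⟨x, y⟩ | ⟨x, y⟩
  · exact hu x y
  · exact hv x y

theorem horizRule_rankCell {u v : ℤ → Bool} {r s : ℤ → ℕ∞} {Q R : ℤ → ℕ∞ → ZMod 4}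
    (hQ : PhaseSystem u r Q) (hR : PhaseSystem v s R) {e : ℤ} (he : ∀ x, r x = 0 ↔ Odd (x - e))
    (x y : ℤ) : HorizRule (rankCell u v r s Q R (x - 1) y) (rankCell u v r s Q R x y) := by
  refine ⟨?_, rfl, rfl, fun hx => ?_, phaseStep_rankCell hQ hR x y, halfStep_rankCell hQ hR x y⟩
  · simp only [rankCell, rankStrand, he]
    rw [show x - 1 - e = x - e - 1 by ring, decide_odd_sub_one, Bool.not_not]
  · have hr : r x = 0 := by simpa [rankCell, rankStrand] using hx
    by_cases hs : s y = 0
    · simp [rankCell, rankStrand, hr, hs]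
    · simp [rankCell, rankStrand, hr, hs, pos_iff_ne_zero]

/-- Completeness of the rules: the true ranks and phases satisfy them. -/
theorem exists_recolor_ofCells_eq {u v : ℤ → Bool} {a b : ℤ_[2]} (hu : IsPaperfolding a u)
    (hv : IsPaperfolding b v) :
    ∃ c ∈ validConfigs HorizRule VertRule, (ofCells c).recolor edgeBit = productTiling u v := by
  obtain ⟨r, Q, hQ, e, he⟩ := hu.exists_phaseSystem
  obtain ⟨s, R, hR, e', he'⟩ := hv.exists_phaseSystem
  refine ⟨rankCell u v r s Q R, fun x y => ⟨horizRule_rankCell hQ hR he x y, ?_⟩, ?_⟩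
  · have := horizRule_rankCell hR hQ he' y x
    rwa [← transpose_rankCell] at this
  · ext z
    cases z <;> rfl

theorem not_isPeriodic_of_recolor_mem {K : Type} {f : K → Bool} {d₁ d₂ : Bool} {T : Tiling K}
    (hT : T.recolor f ∈ shiftsAndReflections d₁ d₂) : ¬ T.IsPeriodic := by
  rintro ⟨p, hp, hshift⟩
  obtain ⟨u, v, h, ⟨a, ha⟩, b, hb⟩ := mem_shiftsAndReflections_iff.1 hT
  have key : ∀ z, (productTiling u v).shift p z = productTiling u v z := by
    intro z
    rw [← h]
    conv_rhs => rw [← hshift]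
    cases z <;> rfl
  exact hp (Prod.ext (ha.eq_zero_of_periodic fun x => key (.vert x 0))
    (hb.eq_zero_of_periodic fun y => key (.horiz 0 y)))

theorem enforcesExactly_and_aperiodic {d₁ d₂ : Bool} {S : Set (Tiling (Cell ⊕ Cell))}
    (hS : ∀ T, T ∈ S ↔ ∃ c ∈ validConfigs HorizRule VertRule, T = ofCells c) :
    EnforcesExactly S edgeBit (shiftsAndReflections d₁ d₂) ∧ ∀ T ∈ S, ¬ T.IsPeriodic := by
  have h : ∀ T ∈ S, T.recolor edgeBit ∈ shiftsAndReflections d₁ d₂ := by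
    intro T hT
    obtain ⟨c, hc, rfl⟩ := (hS T).1 hT
    exact recolor_ofCells_mem hc
  refine ⟨⟨h, fun U hU => ?_⟩, fun T hT => not_isPeriodic_of_recolor_mem (h T hT)⟩
  obtain ⟨u, v, rfl, ⟨a, ha⟩, b, hb⟩ := mem_shiftsAndReflections_iff.1 hU
  obtain ⟨c, hc, hcu⟩ := exists_recolor_ofCells_eq ha hb
  exact ⟨ofCells c, (hS _).2 ⟨c, hc, rfl⟩, hcu⟩

end BracketTiling

theorem theorem1 (d₁ d₂ : Bool) :
    (∃ (K : Type) (_ : Finite K) (f : K → Bool) (P : Set (BracketTiling.Tile K)),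
      BracketTiling.EnforcesExactly (BracketTiling.paletteTilings P) f
          (BracketTiling.shiftsAndReflections d₁ d₂) ∧
        ∀ T ∈ BracketTiling.paletteTilings P, ¬ T.IsPeriodic) ∧
    (∃ (K : Type) (_ : Finite K) (f : K → Bool) (P : Set (BracketTiling.Cross K)),
      BracketTiling.EnforcesExactly (BracketTiling.crossPaletteTilings P) f
          (BracketTiling.shiftsAndReflections d₁ d₂) ∧
        ∀ T ∈ BracketTiling.crossPaletteTilings P, ¬ T.IsPeriodic) :=
  ⟨⟨_, inferInstance, _, _, BracketTiling.enforcesExactly_and_aperiodic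
      fun _ => BracketTiling.mem_paletteTilings_tilePalette_iff⟩,
    ⟨_, inferInstance, _, _, BracketTiling.enforcesExactly_and_aperiodic
      fun _ => BracketTiling.mem_crossPaletteTilings_crossPalette_iff⟩⟩
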